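/- Notation. For integers $n,r\ge 0$, positive integers $k_1,\dots,k_r$ and complex numbers $a_1,\dots,a_r$ put $$\zeta_n(k_1,\ldots,k_r;a_1,\ldots,a_r)=\sum_{n\ge n_1>\cdots>n_r>0}\prod_{j=1}^r\frac1{(n_j+a_j-1)^{k_j}},\qquad \zeta^\star_n(k_1,\ldots,k_r;a_1,\ldots,a_r)=\sum_{n\ge n_1\ge\cdots\ge n_r>0}\prod_{j=1}^r\frac1{(n_j+a_j-1)^{k_j}}$$ (both are $1$ for $r=0$, and $\zeta_n=0$ for $n<r$), $\zeta_n(\boldsymbol k;a)=\zeta_n(\boldsymbol k;\{a\}_r)$ and $\zeta^\star_n(\boldsymbol k;a)=\zeta^\star_n(\boldsymbol k;\{a\}_r)$, where $\{a\}_r$ is $a$ repeated $r$ times, and $\zeta(\boldsymbol k;\boldsymbol a)=\lim_{n\to\infty}\zeta_n(\boldsymbol k;\boldsymbol a)$. Further $\binom ab=\frac{\Gamma(a+1)}{\Gamma(b+1)\Gamma(a-b+1)}$, and $\delta_{0,k}$ is the Kronecker delta. Theorem. Let $m\ge -1$ and $k,p\ge 0$ be integers, and let $\alpha,\beta\in\mathbb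 C$ with $\alpha\notin\{0,-1,-2,\ldots\}$, $\Re\beta<1$ and $\Re(\alpha+\beta)<m+2$. Then the series on the left below converges, all limits and series on the right converge, and $$\sum_{n=1}^\infty\frac{\zeta_n(\{1\}_k;\alpha)\,\zeta_n^\star(\{1\}_p;1-\beta)}{n^{m+2}}\,\frac{\binom{n+\alpha-1}{n}}{\binom{n-\beta}{n}}=\sum_{\substack{i_1+\cdots+i_{m+2}=p\\ i_1,\ldots,i_{m+2}\ge 0}}\binom{i_1+k}{k}\Big\{\zeta(i_1+k+1,i_2+1,\ldots,i_{m+2}+1;1-\alpha-\beta,\{1-\beta\}_{m+1})-\delta_{0,k}\,\zeta(i_1+k+1,i_2+1,\ldots,i_{m+2}+1;\{1-\beta\}_{m+2})\Big\},$$ where for $i_1=k=0$ the difference in braces stands for $$\lim_{N\to\infty}\Big(\zeta_N(1,i_2+1,\ldots,i_{m+2}+1;1-\alpha-\beta,\{1-\beta\}_{m+1})-\zeta_N(1,i_2+1,\ldots,i_{m+2}+1;\{1-\beta\}_{m+2})\Big)=\alpha\sum_{n=1}^\infty\frac{\zeta_{n-1}(i_2+1,\ldots,i_{m+2}+1;1-\beta)}{(n-\beta)(n-\alpha-\beta)}.$$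 (In all sums over $n_1>\cdots>n_{m+2}>0$ one has $n_1\ge m+2$, so $n_1-\alpha-\beta\ne 0$; likewise the terms with $n<m+2$ of the last series are $0$.) -/

import Mathlib

open Filter Topology Finset

noncomputable section

/-- The generalized binomial coefficient `Γ(a+1) / (Γ(b+1) Γ(a-b+1))`. -/
def cbinom (a b : ℂ) : ℂ :=
  Complex.Gamma (a + 1) / (Complex.Gamma (b + 1) * Complex.Gamma (a - b + 1))

/-- The Hurwitz-type multiple harmonic sum with `r` variables:
`∑_{n ≥ n₁ > ⋯ > n_r > 0} ∏ j, 1 / (n_j + a_j - 1) ^ k_j`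
(it is `1` for `r = 0`, and `0` for `n < r`). -/
def htmhs {r : ℕ} (n : ℕ) (k : Fin r → ℕ) (a : Fin r → ℂ) : ℂ :=
  ∑ x ∈ (Fintype.piFinset fun _ : Fin r => Finset.Icc 1 n) with StrictAnti x,
    ∏ j, 1 / ((x j : ℂ) + a j - 1) ^ k j

/-- The Hurwitz-type multiple harmonic star sum with `r` variables:
`∑_{n ≥ n₁ ≥ ⋯ ≥ n_r > 0} ∏ j, 1 / (n_j + a_j - 1) ^ k_j`. -/
def htmhss {r : ℕ} (n : ℕ) (k : Fin r → ℕ) (a : Fin r → ℂ) : ℂ :=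
  ∑ x ∈ (Fintype.piFinset fun _ : Fin r => Finset.Icc 1 n) with Antitone x,
    ∏ j, 1 / ((x j : ℂ) + a j - 1) ^ k j

/-- The Hurwitz-type multiple zeta value with `r` variables, the limit of the multiple
harmonic sums (meaningful when the limit exists). -/
def htmzv {r : ℕ} (k : Fin r → ℕ) (a : Fin r → ℂ) : ℂ :=
  limUnder atTop fun n : ℕ => htmhs n k a

/-- The exponents `(i₁ + k + 1, i₂ + 1, …, i_{d+1} + 1)`. -/
def expo {d : ℕ} (k : ℕ) (i : Fin (d + 1) → ℕ) : Fin (d + 1) → ℕ :=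
  Fin.cons (i 0 + k + 1) fun j : Fin d => i j.succ + 1

/-- The variables `(1 - α - β, 1 - β, …, 1 - β)`, with `1 - β` repeated `d` times. -/
def vars (d : ℕ) (α β : ℂ) : Fin (d + 1) → ℂ :=
  Fin.cons (1 - α - β) fun _ : Fin d => 1 - β

/-- The summand with index `n + 1` of the series
`∑_{n ≥ 1} ζ_{n-1}(i₂ + 1, …, i_{d+1} + 1; 1 - β) / ((n - β) (n - α - β))`. -/
def regTerm {d : ℕ} (α β : ℂ) (i : Fin (d + 1) → ℕ) (n : ℕ) : ℂ :=
  htmhs n (fun j : Fin d => i j.succ + 1) (fun _ => 1 - β) /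
    (((n + 1 : ℕ) - β) * ((n + 1 : ℕ) - α - β))

open Classical in
/-- The difference
`ζ(i₁+k+1, i₂+1, …; 1-α-β, 1-β, …) - δ_{0,k} ζ(i₁+k+1, i₂+1, …; 1-β, …, 1-β)`,
where for `i₁ = k = 0` (both values diverge) the difference stands for
`α ∑_{n ≥ 1} ζ_{n-1}(i₂+1, …; 1-β) / ((n-β) (n-α-β))`. -/
def zetaDiff {d : ℕ} (k : ℕ) (α β : ℂ) (i : Fin (d + 1) → ℕ) : ℂ :=
  if i 0 = 0 ∧ k = 0 then α * ∑' n : ℕ, regTerm α β i n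
  else htmzv (expo k i) (vars d α β) -
    (if k = 0 then 1 else 0) * htmzv (expo k i) (fun _ => 1 - β)

/-- The summand of index `n` of the series with two binomial coefficients:
`ζ_n({1}_k; α) ζ⋆_n({1}_p; 1-β) / n^(m+2) * binom (n+α-1) n / binom (n-β) n`. -/
def aperyTerm (m : ℤ) (k p : ℕ) (α β : ℂ) (n : ℕ) : ℂ :=
  htmhs n (fun _ : Fin k => 1) (fun _ => α) * htmhss n (fun _ : Fin p => 1) (fun _ => 1 - β) /
    (n : ℂ) ^ (m + 2) * (cbinom (n + α - 1) n / cbinom (n - β) n)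

end

/-! Let t and s mark k and p, and put x = 1 - β, d = m + 1. The left side is the coefficient of t^k
s^p in F_{d+1}(x), where F_D(y) = ∑_{n≥1} (α+t)_n / ((y-s)_n n^D). Since 1/(y-s)_n - 1/(y+1-s)_n =
n/(y-s)_{n+1}, the difference ΔF_{D+1}(y) = F_{D+1}(y) - F_{D+1}(y+1) equals F_D(y+1)/(y-s)
(`binomSeriesDiff_eq_sum`).

Let Z_j(q) be the generating function in s of the depth-j sums `depthSum`. Summation by parts trades
one power of n for one level of nesting: F_{d+1}(x) = ∑_q ΔF_{D+1}(x+q) Z_j(q) whenever j + D = d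
(`tendsto_sum_binomSeriesDiff_mul_depthSum`). At D = 0 a telescoping series gives ΔF_1(y) =
1/(y-α-s-t) - 1/(y-s) (`binomSeriesDiff_one`); its expansion produces the binomial coefficients and
the δ-term.

Everything is done on coefficients. F_D(x+q) may diverge for small q, but Z_j(q) = 0 for q < j
removes exactly those terms. -/

/-! ### Recursions for multiple harmonic sums -/

theorem htmhs_depth_zero (n : ℕ) (k : Fin 0 → ℕ) (a : Fin 0 → ℂ) : htmhs n k a = 1 := by
  simp [htmhs, Finset.filter_true_of_mem, Subsingleton.strictAnti]

theorem htmhss_depth_zero (n : ℕ) (k : Fin 0 → ℕ) (a : Fin 0 → ℂ) : htmhss n k a = 1 := by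
  simp [htmhss, Finset.filter_true_of_mem, Subsingleton.antitone]

theorem htmhs_zero {r : ℕ} (k : Fin (r + 1) → ℕ) (a : Fin (r + 1) → ℂ) : htmhs 0 k a = 0 := by
  simp [htmhs, Fintype.piFinset_empty]

theorem htmhss_zero {r : ℕ} (k : Fin (r + 1) → ℕ) (a : Fin (r + 1) → ℂ) : htmhss 0 k a = 0 := by
  simp [htmhss, Fintype.piFinset_empty]

theorem strictAnti_fin_succ {r : ℕ} (x : Fin (r + 1) → ℕ) :
    StrictAnti x ↔ (∀ j : Fin r, x j.succ < x 0) ∧ StrictAnti fun j : Fin r => x j.succ := by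
  constructor
  · intro h
    exact ⟨fun j => h (Fin.succ_pos j), fun a b hab => h (Fin.succ_lt_succ_iff.2 hab)⟩
  · rintro ⟨h0, h1⟩ a b hab
    induction b using Fin.cases with
    | zero => simp at hab
    | succ b =>
      induction a using Fin.cases with
      | zero => exact h0 b
      | succ a => exact h1 (Fin.succ_lt_succ_iff.1 hab)

theorem antitone_fin_succ {r : ℕ} (x : Fin (r + 1) → ℕ) :
    Antitone x ↔ (∀ j : Fin r, x j.succ ≤ x 0) ∧ Antitone fun j : Fin r => x j.succ := by
  constructor
  · intro h
    exact ⟨fun j => h (Fin.zero_le _), fun a b hab => h (Fin.succ_le_succ_iff.2 hab)⟩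
  · rintro ⟨h0, h1⟩ a b hab
    induction b using Fin.cases with
    | zero => simp at hab; simp [hab]
    | succ b =>
      induction a using Fin.cases with
      | zero => exact h0 b
      | succ a => exact h1 (Fin.succ_le_succ_iff.1 hab)

/-- Splitting a strict sum according to whether the largest index attains the bound. -/
theorem htmhs_succ {r : ℕ} (n : ℕ) (k : Fin (r + 1) → ℕ) (a : Fin (r + 1) → ℂ) :
    htmhs (n + 1) k a = htmhs n k a +
      1 / ((n : ℂ) + a 0) ^ k 0 * htmhs n (fun j : Fin r => k j.succ) (fun j => a j.succ) := by
  unfold htmhs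
  rw [← Finset.sum_filter_not_add_sum_filter _ (fun x : Fin (r + 1) → ℕ => x 0 = n + 1)]
  congr 1
  · refine Finset.sum_congr ?_ fun _ _ => rfl
    ext x
    simp only [Finset.mem_filter, Fintype.mem_piFinset, Finset.mem_Icc, strictAnti_fin_succ]
    constructor
    · rintro ⟨⟨h1, h2, h3⟩, h4⟩
      have h5 : x 0 ≤ n := by have := (h1 0).2; omega
      refine ⟨fun j => ⟨(h1 j).1, ?_⟩, h2, h3⟩
      induction j using Fin.cases with
      | zero => exact h5
      | succ j => exact (h2 j).le.trans h5
    · rintro ⟨h1, h2, h3⟩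
      exact ⟨⟨fun j => ⟨(h1 j).1, by have := (h1 j).2; omega⟩, h2, h3⟩, by have := (h1 0).2; omega⟩
  · rw [Finset.mul_sum]
    refine Finset.sum_nbij' (fun x j => x (Fin.succ j))
      (fun y => Fin.cons (α := fun _ => ℕ) (n + 1) y) ?_ ?_ ?_ ?_ ?_
    · intro x hx
      simp only [Finset.mem_filter, Fintype.mem_piFinset, Finset.mem_Icc,
        strictAnti_fin_succ x] at hx ⊢
      obtain ⟨⟨h1, h2, h3⟩, h4⟩ := hx
      exact ⟨fun j => ⟨(h1 _).1, by have := h2 j; omega⟩, h3⟩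
    · intro y hy
      simp only [Finset.mem_filter, Fintype.mem_piFinset, Finset.mem_Icc, strictAnti_fin_succ,
        Fin.forall_fin_succ, Fin.cons_zero, Fin.cons_succ] at hy ⊢
      obtain ⟨h1, h2⟩ := hy
      exact ⟨⟨⟨by omega, fun j => ⟨(h1 j).1, by have := (h1 j).2; omega⟩⟩,
        fun j => by have := (h1 j).2; omega, h2⟩, trivial⟩
    · intro x hx
      have h4 := (Finset.mem_filter.1 hx).2
      funext j
      induction j using Fin.cases with
      | zero => exact h4.symm
      | succ j => rfl
    · intro y _
      rfl
    · intro x hx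
      have h4 := (Finset.mem_filter.1 hx).2
      rw [Fin.prod_univ_succ, h4]
      congr 3
      push_cast
      ring

/-- Splitting a star sum according to whether the largest index attains the bound. -/
theorem htmhss_succ {r : ℕ} (n : ℕ) (k : Fin (r + 1) → ℕ) (a : Fin (r + 1) → ℂ) :
    htmhss (n + 1) k a = htmhss n k a +
      1 / ((n : ℂ) + a 0) ^ k 0 *
        htmhss (n + 1) (fun j : Fin r => k j.succ) (fun j => a j.succ) := by
  unfold htmhss
  rw [← Finset.sum_filter_not_add_sum_filter _ (fun x : Fin (r + 1) → ℕ => x 0 = n + 1)]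
  congr 1
  · refine Finset.sum_congr ?_ fun _ _ => rfl
    ext x
    simp only [Finset.mem_filter, Fintype.mem_piFinset, Finset.mem_Icc, antitone_fin_succ]
    constructor
    · rintro ⟨⟨h1, h2, h3⟩, h4⟩
      have h5 : x 0 ≤ n := by have := (h1 0).2; omega
      refine ⟨fun j => ⟨(h1 j).1, ?_⟩, h2, h3⟩
      induction j using Fin.cases with
      | zero => exact h5
      | succ j => exact (h2 j).trans h5
    · rintro ⟨h1, h2, h3⟩
      exact ⟨⟨fun j => ⟨(h1 j).1, by have := (h1 j).2; omega⟩, h2, h3⟩, by have := (h1 0).2; omega⟩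
  · rw [Finset.mul_sum]
    refine Finset.sum_nbij' (fun x j => x (Fin.succ j))
      (fun y => Fin.cons (α := fun _ => ℕ) (n + 1) y) ?_ ?_ ?_ ?_ ?_
    · intro x hx
      simp only [Finset.mem_filter, Fintype.mem_piFinset, Finset.mem_Icc,
        antitone_fin_succ x] at hx ⊢
      obtain ⟨⟨h1, h2, h3⟩, h4⟩ := hx
      exact ⟨fun j => h1 _, h3⟩
    · intro y hy
      simp only [Finset.mem_filter, Fintype.mem_piFinset, Finset.mem_Icc, antitone_fin_succ,
        Fin.forall_fin_succ, Fin.cons_zero, Fin.cons_succ] at hy ⊢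
      obtain ⟨h1, h2⟩ := hy
      exact ⟨⟨⟨by omega, h1⟩, fun j => (h1 j).2, h2⟩, trivial⟩
    · intro x hx
      have h4 := (Finset.mem_filter.1 hx).2
      funext j
      induction j using Fin.cases with
      | zero => exact h4.symm
      | succ j => rfl
    · intro y _
      rfl
    · intro x hx
      have h4 := (Finset.mem_filter.1 hx).2
      rw [Fin.prod_univ_succ, h4]
      congr 3
      push_cast
      ring

theorem htmhs_eq_sum {r : ℕ} (N : ℕ) (k : Fin (r + 1) → ℕ) (a : Fin (r + 1) → ℂ) :
    htmhs N k a = ∑ n ∈ range N,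
      1 / ((n : ℂ) + a 0) ^ k 0 * htmhs n (fun j : Fin r => k j.succ) (fun j => a j.succ) := by
  induction N with
  | zero => simp [htmhs_zero]
  | succ N ih => rw [htmhs_succ, ih, Finset.sum_range_succ]

theorem htmhs_eq_zero {r n : ℕ} (h : n < r) (k : Fin r → ℕ) (a : Fin r → ℂ) :
    htmhs n k a = 0 := by
  induction n generalizing r with
  | zero =>
    obtain ⟨r, rfl⟩ : ∃ r', r = r' + 1 := ⟨r - 1, by omega⟩
    exact htmhs_zero k a
  | succ n ih =>
    obtain ⟨r, rfl⟩ : ∃ r', r = r' + 1 := ⟨r - 1, by omega⟩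
    rw [htmhs_succ, ih (by omega), ih (by omega)]
    simp

/-! ### Coefficients of rising factorials and of their inverses -/

noncomputable section

/-- The product `(α)_n ζ_n({1}_k; α)`, the coefficient of `t ^ k` in `(α + t)_n`. -/
def risingCoeff (α : ℂ) (n k : ℕ) : ℂ :=
  (∏ j ∈ range n, (α + j)) * htmhs n (fun _ : Fin k => 1) (fun _ => α)

/-- The quotient `ζ⋆_n({1}_p; y) / (y)_n`, the coefficient of `s ^ p` in `1 / (y - s)_n`. -/
def invRisingCoeff (y : ℂ) (n p : ℕ) : ℂ :=
  htmhss n (fun _ : Fin p => 1) (fun _ => y) / ∏ j ∈ range n, (y + j)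

/-- The shift of a sequence of coefficients that multiplies its generating function by the
variable. -/
def shiftCoeff (f : ℕ → ℂ) : ℕ → ℂ
  | 0 => 0
  | p + 1 => f p

end

/-- This is (α+t)_{n+1} = (α+n+t) (α+t)_n, read off at t^k. -/
theorem risingCoeff_succ {α : ℂ} (hα : ∀ j : ℕ, α ≠ -(j : ℂ)) (n k : ℕ) :
    risingCoeff α (n + 1) k = (α + n) * risingCoeff α n k + shiftCoeff (risingCoeff α n) k := by
  have h : α + n ≠ 0 := fun h => hα n (eq_neg_of_add_eq_zero_left h)
  unfold risingCoeff
  rw [Finset.prod_range_succ]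
  cases k with
  | zero => simp only [htmhs_depth_zero, shiftCoeff]; ring
  | succ k =>
    rw [htmhs_succ, add_comm (n : ℂ) α]
    simp only [shiftCoeff]
    field_simp

theorem invRisingCoeff_zero (y : ℂ) (p : ℕ) : invRisingCoeff y 0 p = if p = 0 then 1 else 0 := by
  unfold invRisingCoeff
  cases p with
  | zero => simp [htmhss_depth_zero]
  | succ p => simp [htmhss_zero]

theorem risingCoeff_zero (y : ℂ) (p : ℕ) : risingCoeff y 0 p = if p = 0 then 1 else 0 := by
  unfold risingCoeff
  cases p with
  | zero => simp [htmhs_depth_zero]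
  | succ p => simp [htmhs_zero]

theorem add_natCast_ne_zero_of_re_pos {y : ℂ} (hy : 0 < y.re) (n : ℕ) : y + n ≠ 0 := by
  intro h
  have := congrArg Complex.re h
  simp at this
  have : (0 : ℝ) ≤ n := n.cast_nonneg
  linarith

theorem invRisingCoeff_succ {y : ℂ} (hy : 0 < y.re) (n p : ℕ) :
    (y + n) * invRisingCoeff y (n + 1) p =
      invRisingCoeff y n p + shiftCoeff (invRisingCoeff y (n + 1)) p := by
  have h := add_natCast_ne_zero_of_re_pos hy n
  have h' : ∏ j ∈ range n, (y + j) ≠ 0 :=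
    Finset.prod_ne_zero_iff.2 fun j _ => add_natCast_ne_zero_of_re_pos hy j
  unfold invRisingCoeff
  rw [Finset.prod_range_succ]
  cases p with
  | zero => simp only [htmhss_depth_zero, shiftCoeff]; field_simp; simp
  | succ p =>
    rw [htmhss_succ, add_comm (n : ℂ) y]
    simp only [shiftCoeff]
    field_simp

/-- Splitting off the smallest factor of `1 / (y - s)_{n+1}`. -/
theorem invRisingCoeff_succ_left {y : ℂ} (hy : 0 < y.re) (n p : ℕ) :
    y * invRisingCoeff y (n + 1) p =
      invRisingCoeff (y + 1) n p + shiftCoeff (invRisingCoeff y (n + 1)) p := by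
  have hy1 : 0 < (y + 1).re := by simp; linarith
  induction n generalizing p with
  | zero =>
    have := invRisingCoeff_succ hy 0 p
    simpa [invRisingCoeff_zero] using this
  | succ n ih =>
    -- The shift term lowers p at fixed n, so a second induction is needed. Multiplying by y + n + 1
    -- removes the largest factor, which reduces the claim to n.
    induction p with
    | zero =>
      have h := add_natCast_ne_zero_of_re_pos hy (n + 1)
      have h1 := invRisingCoeff_succ hy (n + 1) 0
      have h2 := invRisingCoeff_succ hy1 n 0
      have h3 := ih 0
      simp only [shiftCoeff] at *
      refine mul_left_cancel₀ h ?_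
      push_cast at *
      linear_combination y * h1 - h2 + h3
    | succ p ihp =>
      have h := add_natCast_ne_zero_of_re_pos hy (n + 1)
      have h1 := invRisingCoeff_succ hy (n + 1) (p + 1)
      have h2 := invRisingCoeff_succ hy1 n (p + 1)
      have h3 := ih (p + 1)
      have h4 := invRisingCoeff_succ hy (n + 1) p
      simp only [shiftCoeff] at *
      refine mul_left_cancel₀ h ?_
      push_cast at *
      linear_combination y * h1 - h2 + h3 - h4 + ihp

/-- Removing the smallest or the largest factor of 1/(y-s)_{n+1} leaves the same shift term, which
cancels. -/
theorem invRisingCoeff_sub {y : ℂ} (hy : 0 < y.re) (n p : ℕ) :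
    invRisingCoeff y n p - invRisingCoeff (y + 1) n p = n * invRisingCoeff y (n + 1) p := by
  linear_combination invRisingCoeff_succ_left hy n p - invRisingCoeff_succ hy n p

/-- Division by y - s through the geometric series ∑ s^a / y^(a+1). -/
theorem eq_sum_of_shiftCoeff {f g : ℕ → ℂ} {y : ℂ} (hy : y ≠ 0)
    (h : ∀ p, y * f p = g p + shiftCoeff f p) (p : ℕ) :
    f p = ∑ ab ∈ antidiagonal p, 1 / y ^ (ab.1 + 1) * g ab.2 := by
  induction p with
  | zero =>
    have := h 0
    simp only [shiftCoeff, add_zero] at this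
    simp [← this, hy]
  | succ p ih =>
    have := h (p + 1)
    simp only [shiftCoeff] at this
    rw [Finset.Nat.sum_antidiagonal_succ]
    refine mul_left_cancel₀ hy ?_
    rw [this, ih, mul_add, Finset.mul_sum]
    congr 1
    · field_simp
      simp
    · refine Finset.sum_congr rfl fun ab _ => ?_
      field_simp
      ring

theorem sum_antidiagonalTuple_succ (d p : ℕ) (f : (Fin (d + 1) → ℕ) → ℂ) :
    ∑ i ∈ Finset.Nat.antidiagonalTuple (d + 1) p, f i =
      ∑ ab ∈ antidiagonal p, ∑ i ∈ Finset.Nat.antidiagonalTuple d ab.2,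
        f (Fin.cons (α := fun _ => ℕ) ab.1 i) := by
  rw [Finset.sum_sigma']
  refine Finset.sum_bij' (fun i _ => ⟨(i 0, ∑ j : Fin d, i j.succ), fun j => i j.succ⟩)
    (fun i _ => Fin.cons (α := fun _ => ℕ) i.1.1 i.2) ?_ ?_ ?_ ?_ ?_
  · intro i hi
    rw [Finset.Nat.mem_antidiagonalTuple, Fin.sum_univ_succ] at hi
    simpa [Finset.Nat.mem_antidiagonalTuple] using hi
  · rintro ⟨⟨a, b⟩, i⟩ hi
    simp only [Finset.mem_sigma, Finset.HasAntidiagonal.mem_antidiagonal, Finset.Nat.mem_antidiagonalTuple] at hi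
    rw [Finset.Nat.mem_antidiagonalTuple, Fin.sum_univ_succ]
    simp only [Fin.cons_zero, Fin.cons_succ]
    omega
  · intro i _
    funext j
    induction j using Fin.cases <;> rfl
  · rintro ⟨⟨a, b⟩, i⟩ hi
    simp only [Finset.mem_sigma, Finset.HasAntidiagonal.mem_antidiagonal, Finset.Nat.mem_antidiagonalTuple] at hi
    obtain ⟨-, rfl⟩ := hi
    rfl
  · intro i _
    congr 1
    funext j
    induction j using Fin.cases <;> rfl

/-! ### Growth estimates -/

theorem exists_le_of_tendsto {f : ℕ → ℝ} {l : ℝ} (h : Tendsto f atTop (𝓝 l)) :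
    ∃ C, 0 ≤ C ∧ ∀ n, f n ≤ C := by
  obtain ⟨C, hC⟩ := h.bddAbove_range
  exact ⟨max C 0, le_max_right _ _, fun n => (hC ⟨n, rfl⟩).trans (le_max_left _ _)⟩

theorem tendsto_natCast_div_add (c : ℂ) :
    Tendsto (fun n : ℕ => ((n : ℂ) + 1) / (n + c)) atTop (𝓝 1) := by
  have h0 : Tendsto (fun n : ℕ => (n : ℂ) / (n + (c - 1))) atTop (𝓝 1) := by
    exact tendsto_natCast_div_add_atTop (c - 1)
  have := (tendsto_add_atTop_iff_nat 1).2 h0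
  refine this.congr fun n => ?_
  push_cast
  ring_nf

/-- Each factor of a multiple harmonic sum is `O(1 / n)`. -/
theorem exists_norm_one_div_pow_le (a : ℂ) (k : ℕ) :
    ∃ C : ℝ, 0 ≤ C ∧ ∀ n : ℕ, ‖1 / ((n : ℂ) + a) ^ k‖ ≤ C / ((n : ℝ) + 1) ^ k := by
  have h := ((tendsto_natCast_div_add a).norm.pow k)
  obtain ⟨C, hC, hn⟩ := exists_le_of_tendsto h
  refine ⟨C, hC, fun n => ?_⟩
  have hp : (0 : ℝ) < (n : ℝ) + 1 := by positivity
  rw [le_div_iff₀ (by positivity)]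
  refine le_trans (le_of_eq ?_) (hn n)
  have : ‖(n : ℂ) + 1‖ = (n : ℝ) + 1 := by
    have : (n : ℂ) + 1 = ((n + 1 : ℕ) : ℂ) := by push_cast; rfl
    rw [this, Complex.norm_natCast]; push_cast; rfl
  rw [norm_div, norm_div, norm_pow, this, div_pow, norm_one]
  ring

noncomputable section

/-- The sum `∑_{m ≤ n} 1 / |m + a - 1| ^ k`. -/
def normHarmonic (a : ℂ) (k n : ℕ) : ℝ :=
  ∑ m ∈ Finset.Icc 1 n, ‖1 / ((m : ℂ) + a - 1) ^ k‖

end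

theorem normHarmonic_nonneg (a : ℂ) (k n : ℕ) : 0 ≤ normHarmonic a k n :=
  Finset.sum_nonneg fun _ _ => norm_nonneg _

theorem normHarmonic_mono (a : ℂ) (k n : ℕ) : normHarmonic a k n ≤ normHarmonic a k (n + 1) :=
  Finset.sum_le_sum_of_subset_of_nonneg (Finset.Icc_subset_Icc_right n.le_succ)
    fun _ _ _ => norm_nonneg _

/-- Without the order condition the sum factors into one-variable sums; the bound serves strict and
star sums alike. -/
theorem norm_sum_filter_prod_le {r : ℕ} (n : ℕ) (k : Fin r → ℕ) (a : Fin r → ℂ)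
    (P : (Fin r → ℕ) → Prop) [DecidablePred P] :
    ‖∑ x ∈ (Fintype.piFinset fun _ : Fin r => Finset.Icc 1 n) with P x,
      ∏ j, 1 / ((x j : ℂ) + a j - 1) ^ k j‖ ≤ ∏ j, normHarmonic (a j) (k j) n := by
  unfold normHarmonic
  rw [Finset.prod_univ_sum]
  refine (norm_sum_le _ _).trans ?_
  simp only [norm_prod]
  exact Finset.sum_le_sum_of_subset_of_nonneg (Finset.filter_subset _ _)
    fun _ _ _ => Finset.prod_nonneg fun _ _ => norm_nonneg _

theorem norm_htmhs_le {r : ℕ} (n : ℕ) (k : Fin r → ℕ) (a : Fin r → ℂ) :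
    ‖htmhs n k a‖ ≤ ∏ j, normHarmonic (a j) (k j) n :=
  norm_sum_filter_prod_le n k a _

theorem norm_htmhss_le {r : ℕ} (n : ℕ) (k : Fin r → ℕ) (a : Fin r → ℂ) :
    ‖htmhss n k a‖ ≤ ∏ j, normHarmonic (a j) (k j) n :=
  norm_sum_filter_prod_le n k a _

theorem sum_one_div_le (n : ℕ) {δ : ℝ} (hδ : 0 < δ) :
    ∑ m ∈ range (n + 1), 1 / ((m : ℝ) + 1) ≤ (1 + 1 / δ) * ((n : ℝ) + 1) ^ δ := by
  have h1 := harmonic_le_one_add_log (n + 1)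
  have h2 : ((harmonic (n + 1) : ℚ) : ℝ) = ∑ m ∈ range (n + 1), 1 / ((m : ℝ) + 1) := by
    simp [harmonic]
  have h3 : Real.log ((n : ℝ) + 1) ≤ ((n : ℝ) + 1) ^ δ / δ :=
    Real.log_le_rpow_div (by positivity) hδ
  have h4 : 1 ≤ ((n : ℝ) + 1) ^ δ :=
    Real.one_le_rpow (by have : (0 : ℝ) ≤ n := n.cast_nonneg; linarith) hδ.le
  rw [h2] at h1
  push_cast at h1
  calc _ ≤ _ := h1
    _ ≤ ((n : ℝ) + 1) ^ δ + ((n : ℝ) + 1) ^ δ / δ := add_le_add h4 h3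
    _ = _ := by ring

theorem exists_normHarmonic_le (a : ℂ) {k : ℕ} (hk : 1 ≤ k) {δ : ℝ} (hδ : 0 < δ) :
    ∃ C : ℝ, 0 ≤ C ∧ ∀ n : ℕ, normHarmonic a k (n + 1) ≤ C * ((n : ℝ) + 1) ^ δ := by
  obtain ⟨C, hC, hn⟩ := exists_norm_one_div_pow_le a k
  refine ⟨C * (1 + 1 / δ), by positivity, fun n => ?_⟩
  rw [mul_assoc]
  refine le_trans ?_ (mul_le_mul_of_nonneg_left (sum_one_div_le n hδ) hC)
  unfold normHarmonic
  rw [Finset.mul_sum, Finset.range_eq_Ico,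
    show Finset.Icc 1 (n + 1) = Finset.Ico (0 + 1) (n + 1 + 1) by ext; simp,
    ← Finset.sum_Ico_add' (fun m : ℕ => ‖1 / ((m : ℂ) + a - 1) ^ k‖) 0 (n + 1) 1]
  refine Finset.sum_le_sum fun m _ => ?_
  have h1 : (1 : ℝ) ≤ (m : ℝ) + 1 := by have : (0 : ℝ) ≤ m := m.cast_nonneg; linarith
  calc _ = ‖1 / ((m : ℂ) + a) ^ k‖ := by push_cast; ring_nf
    _ ≤ C / ((m : ℝ) + 1) ^ k := hn m
    _ ≤ C / ((m : ℝ) + 1) := by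
      gcongr
      exact le_self_pow₀ h1 (by omega)
    _ = _ := by ring

theorem exists_prod_normHarmonic_le {r : ℕ} (a : Fin r → ℂ) {k : Fin r → ℕ}
    (hk : ∀ j, 1 ≤ k j) {δ : ℝ} (hδ : 0 < δ) :
    ∃ C : ℝ, 0 ≤ C ∧ ∀ n : ℕ,
      ∏ j, normHarmonic (a j) (k j) (n + 1) ≤ C * ((n : ℝ) + 1) ^ δ := by
  -- Each of the r factors gets the exponent δ/(r+1), which also makes sense for r = 0.
  have hr : (0 : ℝ) < r + 1 := by positivity
  choose C hC hn using fun j => exists_normHarmonic_le (a j) (hk j) (div_pos hδ hr)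
  refine ⟨∏ j, C j, Finset.prod_nonneg fun j _ => hC j, fun n => ?_⟩
  have h1 : (1 : ℝ) ≤ (n : ℝ) + 1 := by have : (0 : ℝ) ≤ n := n.cast_nonneg; linarith
  calc _ ≤ ∏ j, (C j * ((n : ℝ) + 1) ^ (δ / (r + 1))) :=
        Finset.prod_le_prod (fun j _ => normHarmonic_nonneg _ _ _) fun j _ => hn j n
    _ = (∏ j, C j) * ((n : ℝ) + 1) ^ (δ / (r + 1) * r) := by
        rw [Finset.prod_mul_distrib]
        congr 1
        rw [Finset.prod_const, Finset.card_univ, Fintype.card_fin, ← Real.rpow_natCast,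
          ← Real.rpow_mul (by positivity)]
    _ ≤ _ := by
        refine mul_le_mul_of_nonneg_left ?_ (Finset.prod_nonneg fun j _ => hC j)
        refine Real.rpow_le_rpow_of_exponent_le h1 ?_
        rw [div_mul_eq_mul_div, div_le_iff₀ hr]
        nlinarith

theorem exists_norm_htmhs_le {r : ℕ} (a : Fin r → ℂ) {k : Fin r → ℕ}
    (hk : ∀ j, 1 ≤ k j) {δ : ℝ} (hδ : 0 < δ) :
    ∃ C : ℝ, 0 ≤ C ∧ ∀ n : ℕ, ‖htmhs n k a‖ ≤ C * ((n : ℝ) + 1) ^ δ := by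
  obtain ⟨C, hC, hn⟩ := exists_prod_normHarmonic_le a hk hδ
  refine ⟨C, hC, fun n => (norm_htmhs_le n k a).trans (le_trans ?_ (hn n))⟩
  exact Finset.prod_le_prod (fun j _ => normHarmonic_nonneg _ _ _)
    fun j _ => normHarmonic_mono _ _ _

/-- The growth of a quotient of two rising factorials. -/
theorem exists_rising_div_le {α : ℂ} (hα : ∀ j : ℕ, α ≠ -(j : ℂ)) (y : ℂ) :
    ∃ C : ℝ, 0 ≤ C ∧ ∀ n : ℕ,
      ‖∏ j ∈ range (n + 1), (α + j)‖ / ‖∏ j ∈ range (n + 1), (y + j)‖ ≤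
        C * ((n : ℝ) + 1) ^ (α.re - y.re) := by
  -- By Euler's limit n^z n!/(z)_{n+1} → Γ(z), the normalized quotient converges, hence is bounded.
  have h1 := ((Complex.GammaSeq_tendsto_Gamma y).div (Complex.GammaSeq_tendsto_Gamma α)
    (Complex.Gamma_ne_zero hα)).norm
  -- This replaces powers of n by powers of n + 1, so that the bound includes n = 0.
  have h2 : Tendsto (fun n : ℕ => ((n : ℝ) / (n + 1)) ^ (α.re - y.re)) atTop (𝓝 1) := by
    have := (tendsto_natCast_div_add_atTop (1 : ℝ)).rpow_const (p := α.re - y.re)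
      (Or.inl one_ne_zero)
    simpa using this
  have h3 := h1.mul h2
  have key : Tendsto (fun n : ℕ =>
      ‖∏ j ∈ range (n + 1), (α + j)‖ / ‖∏ j ∈ range (n + 1), (y + j)‖ /
        ((n : ℝ) + 1) ^ (α.re - y.re)) atTop (𝓝 (‖Complex.Gamma y / Complex.Gamma α‖ * 1)) := by
    refine h3.congr' ?_
    filter_upwards [eventually_gt_atTop 0] with n hn
    have hn' : (0 : ℝ) < n := by exact_mod_cast hn
    have hA : ∏ j ∈ range (n + 1), (α + j) ≠ 0 := Finset.prod_ne_zero_iff.2 fun j _ h =>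
      hα j (eq_neg_of_add_eq_zero_left h)
    have hA' : ‖∏ j ∈ range (n + 1), (α + j)‖ ≠ 0 := norm_ne_zero_iff.2 hA
    have hf : (n.factorial : ℝ) ≠ 0 := by exact_mod_cast n.factorial_ne_zero
    simp only [Pi.div_apply, Complex.GammaSeq, norm_div, norm_mul, Complex.norm_natCast_cpow_of_pos hn,
      Complex.norm_natCast]
    rw [Real.div_rpow (by positivity) (by positivity), Real.rpow_sub hn']
    have e1 : (n : ℝ) ^ α.re ≠ 0 := (Real.rpow_pos_of_pos hn' _).ne'
    have e2 : (n : ℝ) ^ y.re ≠ 0 := (Real.rpow_pos_of_pos hn' _).ne'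
    field_simp
  obtain ⟨C, hC, hn⟩ := exists_le_of_tendsto key
  refine ⟨C, hC, fun n => ?_⟩
  have := hn n
  rwa [div_le_iff₀ (by positivity)] at this

/-! ### Convergence of the series and decay under shifts -/

noncomputable section

/-- A majorant of `invRisingCoeff`. -/
def invRisingBound (y : ℂ) (n p : ℕ) : ℝ :=
  normHarmonic y 1 n ^ p / ‖∏ j ∈ range n, (y + j)‖

/-- The series `∑_{n ≥ 1} (α)_n ζ_n({1}_k; α) ζ⋆_n({1}_p; y) / ((y)_n n ^ D)`. -/
def binomSeries (α y : ℂ) (D k p : ℕ) : ℂ :=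
  ∑' n : ℕ, risingCoeff α (n + 1) k * invRisingCoeff y (n + 1) p / ((n : ℂ) + 1) ^ D

end

theorem norm_add_le_norm_add_natCast {y : ℂ} (hy : 0 < y.re) (q : ℕ) : ‖y‖ ≤ ‖y + q‖ := by
  rw [Complex.norm_def, Complex.norm_def]
  refine Real.sqrt_le_sqrt ?_
  simp only [Complex.normSq_apply, Complex.add_re, Complex.add_im, Complex.natCast_re,
    Complex.natCast_im, add_zero]
  have : (0 : ℝ) ≤ q := q.cast_nonneg
  nlinarith

/-- Since |y+j| ≤ |y+q+j|, the shift by q can be dropped everywhere except in the factor j = 0. This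
keeps a decay of order 1/q with a majorant independent of q. -/
theorem norm_invRisingCoeff_le {y : ℂ} (hy : 0 < y.re) (q n p : ℕ) :
    ‖invRisingCoeff (y + q) (n + 1) p‖ ≤ ‖y‖ / ‖y + q‖ * invRisingBound y (n + 1) p := by
  have hq : ∀ j : ℕ, ‖y + j‖ ≤ ‖y + q + j‖ := fun j => by
    have h := norm_add_le_norm_add_natCast (y := y + j) (by simp; positivity) q
    rwa [add_right_comm] at h
  have hpos : ∀ j : ℕ, 0 < ‖y + j‖ := fun j =>
    norm_pos_iff.2 (add_natCast_ne_zero_of_re_pos hy j)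
  have h1 : ‖htmhss (n + 1) (fun _ : Fin p => 1) (fun _ => y + q)‖ ≤
      normHarmonic y 1 (n + 1) ^ p := by
    refine (norm_htmhss_le _ _ _).trans ?_
    rw [Finset.prod_const, Finset.card_univ, Fintype.card_fin]
    refine pow_le_pow_left₀ (normHarmonic_nonneg _ _ _) ?_ p
    refine Finset.sum_le_sum fun m hm => ?_
    obtain ⟨m, rfl⟩ : ∃ m', m = m' + 1 := ⟨m - 1, by have := (Finset.mem_Icc.1 hm).1; omega⟩
    simp only [pow_one, norm_div, norm_one]
    have e1 : ((m + 1 : ℕ) : ℂ) + (y + q) - 1 = y + q + m := by push_cast; ring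
    have e2 : ((m + 1 : ℕ) : ℂ) + y - 1 = y + m := by push_cast; ring
    rw [e1, e2]
    exact one_div_le_one_div_of_le (hpos m) (hq m)
  unfold invRisingCoeff invRisingBound
  rw [norm_div, Finset.prod_range_succ', Finset.prod_range_succ' (fun j : ℕ => y + (j : ℂ))]
  simp only [norm_mul, norm_prod, Nat.cast_zero, add_zero]
  have hy0 : 0 < ‖y‖ := by simpa using hpos 0
  have hyq : 0 < ‖y + q‖ := hpos q
  have hP : 0 < ∏ j ∈ range n, ‖y + ((j + 1 : ℕ) : ℂ)‖ := Finset.prod_pos fun j _ => hpos _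
  have hPQ : ∏ j ∈ range n, ‖y + ((j + 1 : ℕ) : ℂ)‖ ≤
      ∏ j ∈ range n, ‖y + q + ((j + 1 : ℕ) : ℂ)‖ :=
    Finset.prod_le_prod (fun j _ => norm_nonneg _) fun j _ => hq _
  have hH := pow_nonneg (normHarmonic_nonneg y 1 (n + 1)) p
  calc _ ≤ normHarmonic y 1 (n + 1) ^ p / ((∏ j ∈ range n, ‖y + ((j + 1 : ℕ) : ℂ)‖) * ‖y + q‖) := by
        gcongr
    _ = _ := by field_simp

theorem exists_risingCoeff_mul_bound_le {α : ℂ} (hα : ∀ j : ℕ, α ≠ -(j : ℂ)) (y : ℂ)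
    (k p : ℕ) {δ : ℝ} (hδ : 0 < δ) :
    ∃ C : ℝ, 0 ≤ C ∧ ∀ n : ℕ,
      ‖risingCoeff α (n + 1) k‖ * invRisingBound y (n + 1) p ≤
        C * ((n : ℝ) + 1) ^ (α.re - y.re + δ) := by
  obtain ⟨A, hA, hAn⟩ := exists_rising_div_le hα y
  obtain ⟨B, hB, hBn⟩ := exists_prod_normHarmonic_le (fun _ : Fin k => α) (k := fun _ => 1)
    (fun _ => le_rfl) (half_pos hδ)
  obtain ⟨E, hE, hEn⟩ := exists_prod_normHarmonic_le (fun _ : Fin p => y) (k := fun _ => 1)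
    (fun _ => le_rfl) (half_pos hδ)
  refine ⟨A * B * E, by positivity, fun n => ?_⟩
  have h1 := (norm_htmhs_le (n + 1) (fun _ : Fin k => 1) (fun _ => α)).trans (hBn n)
  have h2 := hEn n
  rw [Finset.prod_const, Finset.card_univ, Fintype.card_fin] at h2
  have hp : (0 : ℝ) < (n : ℝ) + 1 := by positivity
  have hH := pow_nonneg (normHarmonic_nonneg y 1 (n + 1)) p
  unfold risingCoeff invRisingBound
  rw [norm_mul]
  calc _ = (‖∏ j ∈ range (n + 1), (α + j)‖ / ‖∏ j ∈ range (n + 1), (y + j)‖) *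
        ‖htmhs (n + 1) (fun _ : Fin k => 1) (fun _ => α)‖ * normHarmonic y 1 (n + 1) ^ p := by ring
    _ ≤ (A * ((n : ℝ) + 1) ^ (α.re - y.re)) * (B * ((n : ℝ) + 1) ^ (δ / 2)) *
        (E * ((n : ℝ) + 1) ^ (δ / 2)) := by
        have := hAn n
        gcongr
    _ = A * B * E * (((n : ℝ) + 1) ^ (α.re - y.re) * ((n : ℝ) + 1) ^ (δ / 2) *
        ((n : ℝ) + 1) ^ (δ / 2)) := by ring
    _ = _ := by
        rw [← Real.rpow_add hp, ← Real.rpow_add hp]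
        congr 2
        ring

theorem summable_natCast_add_one_rpow {c : ℝ} (hc : c < -1) :
    Summable fun n : ℕ => ((n : ℝ) + 1) ^ c := by
  have := (summable_nat_add_iff 1).2 (Real.summable_nat_rpow.2 hc)
  simpa using this

theorem summable_risingCoeff_mul_bound {α y : ℂ} (hα : ∀ j : ℕ, α ≠ -(j : ℂ)) {D : ℕ}
    (h : α.re - y.re + 1 < D) (k p : ℕ) :
    Summable fun n : ℕ =>
      ‖risingCoeff α (n + 1) k‖ * invRisingBound y (n + 1) p / ((n : ℝ) + 1) ^ D := by
  -- Half of the available margin, so that the final exponent stays below -1.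
  set δ : ℝ := (D - (α.re - y.re + 1)) / 2 with hδ
  obtain ⟨C, hC, hn⟩ := exists_risingCoeff_mul_bound_le hα y k p (δ := δ) (by rw [hδ]; linarith)
  refine Summable.of_nonneg_of_le (fun n => ?_) (fun n => ?_)
    ((summable_natCast_add_one_rpow (c := α.re - y.re + δ - D) (by linarith)).mul_left C)
  · have := normHarmonic_nonneg y 1 (n + 1)
    unfold invRisingBound
    positivity
  · have hp : (0 : ℝ) < (n : ℝ) + 1 := by positivity
    rw [div_le_iff₀ (by positivity)]
    refine (hn n).trans (le_of_eq ?_)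
    rw [mul_assoc, ← Real.rpow_natCast, ← Real.rpow_add hp]
    congr 2
    ring

theorem norm_binomSeries_term_le (α : ℂ) {y : ℂ} (hy : 0 < y.re) (D k p q n : ℕ) :
    ‖risingCoeff α (n + 1) k * invRisingCoeff (y + q) (n + 1) p / ((n : ℂ) + 1) ^ D‖ ≤
      ‖y‖ / ‖y + q‖ *
        (‖risingCoeff α (n + 1) k‖ * invRisingBound y (n + 1) p / ((n : ℝ) + 1) ^ D) := by
  have e : ‖(n : ℂ) + 1‖ = (n : ℝ) + 1 := by
    have : (n : ℂ) + 1 = ((n + 1 : ℕ) : ℂ) := by push_cast; rfl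
    rw [this, Complex.norm_natCast]; push_cast; rfl
  rw [norm_div, norm_mul, norm_pow, e]
  have := norm_invRisingCoeff_le hy q n p
  calc _ ≤ ‖risingCoeff α (n + 1) k‖ * (‖y‖ / ‖y + q‖ * invRisingBound y (n + 1) p) /
        ((n : ℝ) + 1) ^ D := by gcongr
    _ = _ := by ring

theorem summable_binomSeries {α y : ℂ} (hα : ∀ j : ℕ, α ≠ -(j : ℂ)) (hy : 0 < y.re) {D : ℕ}
    (h : α.re - y.re + 1 < D) (k p : ℕ) :
    Summable fun n : ℕ =>
      risingCoeff α (n + 1) k * invRisingCoeff y (n + 1) p / ((n : ℂ) + 1) ^ D := by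
  refine Summable.of_norm_bounded
    ((summable_risingCoeff_mul_bound hα h k p).mul_left (‖y‖ / ‖y + (0 : ℕ)‖)) fun n => ?_
  have := norm_binomSeries_term_le α hy D k p 0 n
  simpa using this

theorem exists_norm_binomSeries_le {α y : ℂ} (hα : ∀ j : ℕ, α ≠ -(j : ℂ)) (hy : 0 < y.re)
    {D : ℕ} (h : α.re - y.re + 1 < D) (k p : ℕ) :
    ∃ C : ℝ, 0 ≤ C ∧ ∀ q : ℕ, ‖binomSeries α (y + q) D k p‖ ≤ C / (q + 1) := by
  obtain ⟨B, hB, hBn⟩ := exists_norm_one_div_pow_le y 1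
  have hs := summable_risingCoeff_mul_bound hα h k p
  set T := ∑' n : ℕ, ‖risingCoeff α (n + 1) k‖ * invRisingBound y (n + 1) p / ((n : ℝ) + 1) ^ D
  have hT : 0 ≤ T := tsum_nonneg fun n => by
    have := normHarmonic_nonneg y 1 (n + 1)
    unfold invRisingBound
    positivity
  refine ⟨‖y‖ * B * T, by positivity, fun q => ?_⟩
  refine (tsum_of_norm_bounded (hs.mul_left (‖y‖ / ‖y + q‖)).hasSum
    fun n => norm_binomSeries_term_le α hy D k p q n).trans ?_
  rw [tsum_mul_left]
  have h1 := hBn q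
  rw [pow_one, pow_one, norm_div, norm_one, add_comm (q : ℂ)] at h1
  calc ‖y‖ / ‖y + q‖ * T = ‖y‖ * (1 / ‖y + q‖) * T := by ring
    _ ≤ ‖y‖ * (B / (q + 1)) * T := by gcongr
    _ = _ := by ring

/-! ### The shift difference and its evaluation -/

noncomputable section

/-- The coefficient of `s ^ l` in the generating function of the multiple harmonic sums
`ζ_n({1}_j; x - s)`. -/
def depthSum (x : ℂ) (j n l : ℕ) : ℂ :=
  ∑ i ∈ Finset.Nat.antidiagonalTuple j l, htmhs n (fun t => i t + 1) fun _ => x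

/-- The difference of `binomSeries` under the shift of the second parameter. -/
def binomSeriesDiff (α y : ℂ) (D k p : ℕ) : ℂ :=
  binomSeries α y D k p - binomSeries α (y + 1) D k p

end

theorem depthSum_depth_zero (x : ℂ) (n l : ℕ) : depthSum x 0 n l = if l = 0 then 1 else 0 := by
  unfold depthSum
  cases l <;> simp [htmhs_depth_zero]

theorem depthSum_zero (x : ℂ) (j l : ℕ) : depthSum x (j + 1) 0 l = 0 :=
  Finset.sum_eq_zero fun _ _ => htmhs_zero _ _

theorem depthSum_eq_zero (x : ℂ) {j n : ℕ} (h : n < j) (l : ℕ) : depthSum x j n l = 0 :=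
  Finset.sum_eq_zero fun _ _ => htmhs_eq_zero h _ _

/-- The largest index contributes Z_{j+1}(n+1) - Z_{j+1}(n) = Z_j(n)/(x+n-s). -/
theorem depthSum_succ (x : ℂ) (j n l : ℕ) :
    depthSum x (j + 1) (n + 1) l - depthSum x (j + 1) n l =
      ∑ ab ∈ antidiagonal l, 1 / (x + n) ^ (ab.1 + 1) * depthSum x j n ab.2 := by
  unfold depthSum
  rw [← Finset.sum_sub_distrib, sum_antidiagonalTuple_succ]
  refine Finset.sum_congr rfl fun ab _ => ?_
  rw [Finset.mul_sum]
  refine Finset.sum_congr rfl fun i _ => ?_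
  rw [htmhs_succ]
  simp only [Fin.cons_zero, Fin.cons_succ, add_sub_cancel_left, add_comm (n : ℂ) x]

/-- Any exponent below 1 would do: the bound is set against a decay of order 1/n. -/
theorem exists_norm_depthSum_le (x : ℂ) (j l : ℕ) :
    ∃ C : ℝ, 0 ≤ C ∧ ∀ n : ℕ, ‖depthSum x j n l‖ ≤ C * ((n : ℝ) + 1) ^ (1 / 2 : ℝ) := by
  choose C hC hn using fun i : Fin j → ℕ =>
    exists_norm_htmhs_le (fun _ : Fin j => x) (k := fun t => i t + 1) (fun _ => by omega)
      (δ := 1 / 2) (by norm_num)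
  refine ⟨∑ i ∈ Finset.Nat.antidiagonalTuple j l, C i, Finset.sum_nonneg fun i _ => hC i,
    fun n => ?_⟩
  rw [Finset.sum_mul]
  exact (norm_sum_le _ _).trans (Finset.sum_le_sum fun i _ => hn i n)

/-- The factor n from `invRisingCoeff_sub` cancels one power in the denominator. -/
theorem hasSum_binomSeriesDiff {α y : ℂ} (hα : ∀ j : ℕ, α ≠ -(j : ℂ)) (hy : 0 < y.re) {D : ℕ}
    (h : α.re - y.re < D) (k p : ℕ) :
    HasSum (fun n : ℕ => risingCoeff α (n + 1) k * invRisingCoeff y (n + 2) p / ((n : ℂ) + 1) ^ D)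
      (binomSeriesDiff α y (D + 1) k p) := by
  have hy1 : 0 < (y + 1).re := by simp; linarith
  have h1 := (summable_binomSeries hα hy (D := D + 1) (by push_cast; linarith) k p).hasSum
  have h2 := (summable_binomSeries hα hy1 (D := D + 1) (by push_cast; simp; linarith) k p).hasSum
  refine (h1.sub h2).congr_fun fun n => ?_
  have e := invRisingCoeff_sub hy (n + 1) p
  have hn : (n : ℂ) + 1 ≠ 0 := n.cast_add_one_ne_zero
  push_cast at e
  rw [← sub_div, ← mul_sub, e]
  field_simp
  ring

/-- Termwise (y-s)/(y-s)_{n+1} = 1/(y+1-s)_n: the leftover factor turns the series at y into one at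
y + 1. -/
theorem binomSeriesDiff_succ {α y : ℂ} (hα : ∀ j : ℕ, α ≠ -(j : ℂ)) (hy : 0 < y.re) {D : ℕ}
    (h : α.re - y.re < D) (k p : ℕ) :
    y * binomSeriesDiff α y (D + 1) k p =
      binomSeries α (y + 1) D k p + shiftCoeff (binomSeriesDiff α y (D + 1) k) p := by
  have hy1 : 0 < (y + 1).re := by simp; linarith
  have h1 := (summable_binomSeries hα hy1 (D := D) (by simp; linarith) k p).hasSum
  have h0 := (hasSum_binomSeriesDiff hα hy h k p).mul_left y
  refine h0.unique ?_
  have h2 : HasSum (fun n : ℕ => risingCoeff α (n + 1) k *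
      shiftCoeff (invRisingCoeff y (n + 2)) p / ((n : ℂ) + 1) ^ D)
      (shiftCoeff (binomSeriesDiff α y (D + 1) k) p) := by
    cases p with
    | zero => simp [shiftCoeff]
    | succ p => exact hasSum_binomSeriesDiff hα hy h k p
  refine (h1.add h2).congr_fun fun n => ?_
  have e := invRisingCoeff_succ_left hy (n + 1) p
  linear_combination (risingCoeff α (n + 1) k / ((n : ℂ) + 1) ^ D) * e

theorem binomSeriesDiff_eq_sum {α y : ℂ} (hα : ∀ j : ℕ, α ≠ -(j : ℂ)) (hy : 0 < y.re) {D : ℕ}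
    (h : α.re - y.re < D) (k p : ℕ) :
    binomSeriesDiff α y (D + 1) k p =
      ∑ ab ∈ antidiagonal p, 1 / y ^ (ab.1 + 1) * binomSeries α (y + 1) D k ab.2 :=
  eq_sum_of_shiftCoeff (by simpa using add_natCast_ne_zero_of_re_pos hy 0)
    (fun p => binomSeriesDiff_succ hα hy h k p) p

theorem invRisingCoeff_one {y : ℂ} (hy : 0 < y.re) (p : ℕ) :
    invRisingCoeff y 1 p = 1 / y ^ (p + 1) := by
  have hy0 : y ≠ 0 := by simpa using add_natCast_ne_zero_of_re_pos hy 0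
  have h := fun p => invRisingCoeff_succ hy 0 p
  simp only [Nat.cast_zero, add_zero, zero_add, invRisingCoeff_zero] at h
  induction p with
  | zero =>
    have := h 0
    simp only [shiftCoeff, if_true, add_zero] at this
    field_simp
    simpa [mul_comm] using this
  | succ p ih =>
    have := h (p + 1)
    simp only [shiftCoeff, ih] at this
    refine mul_left_cancel₀ hy0 ?_
    rw [this]
    field_simp
    simp [pow_succ]

theorem tendsto_risingCoeff_mul {α y : ℂ} (hα : ∀ j : ℕ, α ≠ -(j : ℂ)) (hy : 0 < y.re)
    (h : α.re < y.re) (k p : ℕ) :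
    Tendsto (fun n => risingCoeff α n k * invRisingCoeff y n p) atTop (𝓝 0) := by
  rw [← tendsto_add_atTop_iff_nat 1]
  obtain ⟨C, hC, hn⟩ := exists_risingCoeff_mul_bound_le hα y k p
    (δ := (y.re - α.re) / 2) (by linarith)
  have ht : Tendsto (fun n : ℕ => ((n : ℝ) + 1) ^ (-((y.re - α.re) / 2))) atTop (𝓝 0) :=
    (tendsto_rpow_neg_atTop (by linarith)).comp
      (tendsto_natCast_atTop_atTop.atTop_add tendsto_const_nhds)
  refine squeeze_zero_norm (fun n => ?_) (by simpa using ht.const_mul C)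
  have h1 := norm_binomSeries_term_le α hy 0 k p 0 n
  have hy0 : ‖y‖ ≠ 0 := norm_ne_zero_iff.2 (by simpa using add_natCast_ne_zero_of_re_pos hy 0)
  simp only [Nat.cast_zero, add_zero, pow_zero, div_one, div_self hy0, one_mul] at h1
  refine h1.trans ((hn n).trans (le_of_eq ?_))
  congr 2
  ring

/-- The evaluation of the shift difference of the series of exponent one. -/
theorem binomSeriesDiff_one {α y : ℂ} (hα : ∀ j : ℕ, α ≠ -(j : ℂ)) (hy : 0 < y.re)
    (h : α.re < y.re) (k p : ℕ) :
    binomSeriesDiff α y 1 k p = ((p + k).choose k : ℂ) / (y - α) ^ (p + k + 1) -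
      if k = 0 then 1 / y ^ (p + 1) else 0 := by
  have hw : y - α ≠ 0 := fun h0 => by
    have := congrArg Complex.re h0
    simp at this
    linarith
  -- Adding the term n = 0, namely 1/(y-s), gives the full series ∑_{n≥0} (α+t)_n/(y-s)_{n+1}.
  set B : ℕ → ℕ → ℂ := fun k p =>
    binomSeriesDiff α y 1 k p + if k = 0 then 1 / y ^ (p + 1) else 0 with hB
  have hs : ∀ k p, HasSum (fun n : ℕ => risingCoeff α n k * invRisingCoeff y (n + 1) p)
      (B k p) := by
    intro k p
    have h1 := hasSum_binomSeriesDiff hα hy (D := 0) (by simpa using h) k p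
    simp only [pow_zero, div_one] at h1
    have h2 := (hasSum_nat_add_iff
      (f := fun n : ℕ => risingCoeff α n k * invRisingCoeff y (n + 1) p) 1).1 h1
    simpa [hB, risingCoeff_zero, invRisingCoeff_one hy] using h2
  -- This is (y-α-s-t) B = 1: after multiplication the terms are differences of consecutive
  -- (α+t)_n/(y-s)_n, which tend to 0 coefficientwise because Re α < Re y.
  have hrec : ∀ k p, (y - α) * B k p = (if k = 0 ∧ p = 0 then 1 else 0) +
      (shiftCoeff (fun k' => B k' p) k + shiftCoeff (B k) p) := by
    intro k p
    have h1 : HasSum (fun n : ℕ => shiftCoeff (risingCoeff α n) k * invRisingCoeff y (n + 1) p)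
        (shiftCoeff (fun k' => B k' p) k) := by
      cases k with
      | zero => simp [shiftCoeff]
      | succ k => exact hs k p
    have h2 : HasSum (fun n : ℕ => risingCoeff α n k * shiftCoeff (invRisingCoeff y (n + 1)) p)
        (shiftCoeff (B k) p) := by
      cases p with
      | zero => simp [shiftCoeff]
      | succ p => exact hs k p
    have h3 := (((hs k p).mul_left (y - α)).sub (h1.add h2)).tendsto_sum_nat
    have h4 := (tendsto_risingCoeff_mul hα hy h k p).const_sub
      (risingCoeff α 0 k * invRisingCoeff y 0 p)
    have h5 := tendsto_nhds_unique h3 (h4.congr fun N => ?_)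
    · rw [sub_zero, risingCoeff_zero, invRisingCoeff_zero] at h5
      rw [sub_eq_iff_eq_add.1 h5]
      congr 1
      split_ifs <;> simp_all
    · rw [← Finset.sum_range_sub' (fun n => risingCoeff α n k * invRisingCoeff y n p)]
      refine Finset.sum_congr rfl fun n _ => ?_
      linear_combination invRisingCoeff y (n + 1) p * -risingCoeff_succ hα n k -
        risingCoeff α n k * invRisingCoeff_succ hy n p
  -- The recursion determines the coefficients of 1/(y-α-s-t); its inductive step is Pascal's rule.
  have hmain : ∀ k p, B k p = ((p + k).choose k : ℂ) / (y - α) ^ (p + k + 1) := by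
    intro k
    induction k with
    | zero =>
      intro p
      induction p with
      | zero =>
        refine mul_left_cancel₀ hw ?_
        rw [hrec]
        simp [shiftCoeff, hw]
      | succ p ih =>
        refine mul_left_cancel₀ hw ?_
        rw [hrec]
        simp only [shiftCoeff, ih]
        field_simp
        simp [pow_succ']
    | succ k ihk =>
      intro p
      induction p with
      | zero =>
        refine mul_left_cancel₀ hw ?_
        rw [hrec]
        simp only [shiftCoeff, ihk]
        field_simp
        simp [pow_succ']
      | succ p ih =>
        refine mul_left_cancel₀ hw ?_
        rw [hrec]
        simp only [shiftCoeff, ihk, ih]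
        rw [show p + 1 + (k + 1) = p + k + 1 + 1 by ring, Nat.choose_succ_succ,
          show p + 1 + k = p + k + 1 by ring, show p + (k + 1) = p + k + 1 by ring]
        push_cast
        field_simp
        simp only [and_self, if_false]
        ring
  rw [← hmain]
  simp [hB]

/-! ### Iterated summation by parts -/

/-- Moves the factor 1/(x+q-s) from the shift difference onto Z_j(q). -/
theorem sum_antidiagonal_convolution_assoc (u s z : ℕ → ℂ) (p : ℕ) :
    ∑ ab ∈ antidiagonal p, (∑ cd ∈ antidiagonal ab.1, u cd.1 * s cd.2) * z ab.2 =
      ∑ ab ∈ antidiagonal p, s ab.1 * ∑ cd ∈ antidiagonal ab.2, u cd.1 * z cd.2 := by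
  have h : PowerSeries.mk u * PowerSeries.mk s * PowerSeries.mk z =
      PowerSeries.mk s * (PowerSeries.mk u * PowerSeries.mk z) := by ring
  simpa [PowerSeries.coeff_mul] using congrArg (PowerSeries.coeff p) h

theorem sum_range_by_parts (z s : ℕ → ℂ) (hz : z 0 = 0) (N : ℕ) :
    ∑ q ∈ range N, s (q + 1) * (z (q + 1) - z q) =
      s N * z N + ∑ q ∈ range N, (s q - s (q + 1)) * z q := by
  induction N with
  | zero => simp [hz]
  | succ N ih => rw [Finset.sum_range_succ, Finset.sum_range_succ, ih]; ring

/-- The boundary term of the summation by parts. From the base point x + j, where the series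
converges, the decay 1/q beats the growth N^(1/2). -/
theorem tendsto_binomSeries_mul_depthSum {α x : ℂ} (hα : ∀ j : ℕ, α ≠ -(j : ℂ)) (hx : 0 < x.re)
    {j D : ℕ} (h : α.re - x.re + 1 < j + D) (j' k p l : ℕ) :
    Tendsto (fun N : ℕ => binomSeries α (x + N) D k p * depthSum x j' N l) atTop (𝓝 0) := by
  obtain ⟨C, hC, hn⟩ := exists_norm_binomSeries_le (y := x + j) hα (by simp; positivity)
    (D := D) (by simp; linarith) k p
  obtain ⟨B, hB, hBn⟩ := exists_norm_depthSum_le x j' l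
  have ht : Tendsto (fun n : ℕ => ((n : ℝ) + 1) ^ (-(1 / 2) : ℝ)) atTop (𝓝 0) :=
    (tendsto_rpow_neg_atTop (by norm_num)).comp
      (tendsto_natCast_atTop_atTop.atTop_add tendsto_const_nhds)
  refine squeeze_zero_norm' (a := fun N : ℕ => (C * (j + 1) * B) * ((N : ℝ) + 1) ^ (-(1 / 2) : ℝ))
    ?_ (by simpa using ht.const_mul (C * (j + 1) * B))
  filter_upwards [eventually_ge_atTop j] with N hN
  obtain ⟨q, rfl⟩ := Nat.exists_eq_add_of_le hN
  have h1 := hn q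
  have h2 := hBn (j + q)
  have hp : (0 : ℝ) < ((j + q : ℕ) : ℝ) + 1 := by positivity
  rw [norm_mul, show x + ((j + q : ℕ) : ℂ) = x + j + q by push_cast; ring]
  calc _ ≤ C / (q + 1) * (B * (((j + q : ℕ) : ℝ) + 1) ^ (1 / 2 : ℝ)) := by gcongr
    _ ≤ (C * (j + 1) / (((j + q : ℕ) : ℝ) + 1)) * (B * (((j + q : ℕ) : ℝ) + 1) ^ (1 / 2 : ℝ)) := by
        refine mul_le_mul_of_nonneg_right ?_ (by positivity)
        -- The comparison is j + q + 1 ≤ (j+1)(q+1).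
        rw [div_le_div_iff₀ (by positivity) hp]
        push_cast
        have : (0 : ℝ) ≤ C * (j * q) := by positivity
        nlinarith
    _ = (C * (j + 1) * B) * ((((j + q : ℕ) : ℝ) + 1) ^ (1 / 2 : ℝ) *
          (((j + q : ℕ) : ℝ) + 1) ^ (-1 : ℝ)) := by
        rw [Real.rpow_neg_one]
        field_simp
    _ = _ := by
        rw [← Real.rpow_add hp]
        norm_num

/-- The sum is invariant along j + D = d. For j = 0 it telescopes, as Z_0 = 1; each step to j + 1 is
one summation by parts with vanishing boundary term. -/
theorem tendsto_sum_binomSeriesDiff_mul_depthSum {α x : ℂ} (hα : ∀ j : ℕ, α ≠ -(j : ℂ))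
    (hx : 0 < x.re) {d : ℕ} (h : α.re - x.re < d) (k p j D : ℕ) (hjD : j + D = d) :
    Tendsto (fun N => ∑ ab ∈ antidiagonal p, ∑ q ∈ range N,
      binomSeriesDiff α (x + q) (D + 1) k ab.1 * depthSum x j q ab.2) atTop
      (𝓝 (binomSeries α x (d + 1) k p)) := by
  induction j generalizing D with
  | zero =>
    obtain rfl : D = d := by omega
    have h1 := tendsto_binomSeries_mul_depthSum hα hx (j := 0) (D := D + 1)
      (by push_cast; linarith) 0 k p 0
    have h2 := h1.const_sub (binomSeries α x (D + 1) k p)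
    rw [sub_zero] at h2
    refine h2.congr fun N => ?_
    rw [Finset.sum_eq_single (p, 0)]
    · simp only [depthSum_depth_zero, if_true, mul_one]
      have := Finset.sum_range_sub' (fun q : ℕ => binomSeries α (x + q) (D + 1) k p) N
      simp only [Nat.cast_zero, add_zero] at this
      rw [← this]
      refine Finset.sum_congr rfl fun q _ => ?_
      simp [binomSeriesDiff, add_assoc]
    · rintro ⟨a, b⟩ hab hne
      refine Finset.sum_eq_zero fun q _ => ?_
      rw [depthSum_depth_zero, if_neg, mul_zero]
      rintro rfl
      simp at hab
      exact hne (by simp [hab])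
    · simp
  | succ j ih =>
    have h1 := ih (D + 1) (by omega)
    have hjd : (j : ℝ) + 1 + D = d := by exact_mod_cast hjD
    have h2 : Tendsto (fun N : ℕ => ∑ ab ∈ antidiagonal p,
        binomSeries α (x + N) (D + 1) k ab.1 * depthSum x (j + 1) N ab.2) atTop (𝓝 0) := by
      rw [← Finset.sum_const_zero (s := antidiagonal p)]
      exact tendsto_finsetSum _ fun ab _ =>
        tendsto_binomSeries_mul_depthSum hα hx (j := j + 1) (by push_cast; linarith) _ _ _ _
    have h3 := h1.sub h2
    rw [sub_zero] at h3
    refine h3.congr fun N => ?_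
    rw [sub_eq_iff_eq_add', ← Finset.sum_add_distrib]
    have key : ∀ q : ℕ, ∑ ab ∈ antidiagonal p,
        binomSeriesDiff α (x + q) (D + 1 + 1) k ab.1 * depthSum x j q ab.2 =
        ∑ ab ∈ antidiagonal p, binomSeries α (x + (q + 1 : ℕ)) (D + 1) k ab.1 *
          (depthSum x (j + 1) (q + 1) ab.2 - depthSum x (j + 1) q ab.2) := by
      intro q
      -- For q < j the series at x + q + 1 may diverge, but Z_j(q), Z_{j+1}(q) and Z_{j+1}(q+1) all
      -- vanish.
      rcases lt_or_ge q j with hq | hq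
      · rw [Finset.sum_eq_zero, Finset.sum_eq_zero]
        · intro ab _
          rw [depthSum_eq_zero x (by omega), depthSum_eq_zero x (by omega), sub_zero, mul_zero]
        · intro ab _
          rw [depthSum_eq_zero x hq, mul_zero]
      · have hq' : (j : ℝ) ≤ q := by exact_mod_cast hq
        have hxq : 0 < (x + q).re := by simp; positivity
        simp only [depthSum_succ, binomSeriesDiff_eq_sum hα hxq (D := D + 1)
          (by push_cast; simp; linarith)]
        rw [sum_antidiagonal_convolution_assoc (fun c => 1 / (x + (q : ℂ)) ^ (c + 1))
          (binomSeries α (x + q + 1) (D + 1) k) (depthSum x j q)]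
        push_cast
        simp only [add_assoc]
    rw [Finset.sum_comm, Finset.sum_congr rfl fun q _ => key q, Finset.sum_comm]
    refine Finset.sum_congr rfl fun ab _ => ?_
    have hp := sum_range_by_parts (fun q => depthSum x (j + 1) q ab.2)
      (fun q : ℕ => binomSeries α (x + q) (D + 1) k ab.1) (depthSum_zero x j ab.2) N
    have hq : ∀ q : ℕ, binomSeriesDiff α (x + q) (D + 1) k ab.1 =
        binomSeries α (x + q) (D + 1) k ab.1 - binomSeries α (x + (q + 1 : ℕ)) (D + 1) k ab.1 :=
      fun q => by rw [binomSeriesDiff, Nat.cast_add, Nat.cast_one, add_assoc]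
    simp only [hq]
    exact hp

/-! ### Return to binomial coefficients and zeta values -/

theorem cbinom_natCast_add_sub_one {α : ℂ} (hα : ∀ j : ℕ, α ≠ -(j : ℂ)) (n : ℕ) :
    cbinom (n + α - 1) n = (∏ j ∈ range n, (α + j)) / (n.factorial : ℂ) := by
  have hG : ∀ n : ℕ, Complex.Gamma (α + n) = (∏ j ∈ range n, (α + j)) * Complex.Gamma α := by
    intro n
    induction n with
    | zero => simp
    | succ n ih =>
      rw [Finset.prod_range_succ, Nat.cast_add, Nat.cast_one, ← add_assoc, Complex.Gamma_add_one,
        ih]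
      · ring
      · exact fun h => hα n (eq_neg_of_add_eq_zero_left h)
  have h0 := Complex.Gamma_ne_zero hα
  have hf : (n.factorial : ℂ) ≠ 0 := by exact_mod_cast n.factorial_ne_zero
  unfold cbinom
  rw [show (n : ℂ) + α - 1 + 1 = α + n by ring, show (n : ℂ) + α - 1 - n + 1 = α by ring, hG,
    Complex.Gamma_nat_eq_factorial]
  field_simp

theorem aperyTerm_succ {α β : ℂ} (hα : ∀ j : ℕ, α ≠ -(j : ℂ)) (hβ : β.re < 1) (d k p n : ℕ) :
    aperyTerm ((d : ℤ) - 1) k p α β (n + 1) =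
      risingCoeff α (n + 1) k * invRisingCoeff (1 - β) (n + 1) p / ((n : ℂ) + 1) ^ (d + 1) := by
  have hx : 0 < (1 - β).re := by simpa using hβ
  have hx' : ∀ j : ℕ, 1 - β ≠ -(j : ℂ) := fun j h =>
    add_natCast_ne_zero_of_re_pos hx j (by rw [h]; ring)
  have hf : ((n + 1).factorial : ℂ) ≠ 0 := by exact_mod_cast (n + 1).factorial_ne_zero
  have hP : ∏ j ∈ range (n + 1), (1 - β + j) ≠ 0 :=
    Finset.prod_ne_zero_iff.2 fun j _ => add_natCast_ne_zero_of_re_pos hx j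
  have hn : (n : ℂ) + 1 ≠ 0 := n.cast_add_one_ne_zero
  unfold aperyTerm risingCoeff invRisingCoeff
  -- Written this way, the lower binomial has the form of the upper one with 1 - β for α; the
  -- factorials cancel in the quotient.
  rw [show ((n + 1 : ℕ) : ℂ) - β = ((n + 1 : ℕ) : ℂ) + (1 - β) - 1 by ring,
    cbinom_natCast_add_sub_one hα, cbinom_natCast_add_sub_one hx',
    show (d : ℤ) - 1 + 2 = ((d + 1 : ℕ) : ℤ) by push_cast; ring, zpow_natCast]
  push_cast at hf ⊢
  field_simp

theorem exists_tendsto_htmhs {r : ℕ} {k : Fin (r + 1) → ℕ} (a : Fin (r + 1) → ℂ)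
    (h0 : 2 ≤ k 0) (hk : ∀ j : Fin r, 1 ≤ k j.succ) :
    ∃ l, Tendsto (fun N => htmhs N k a) atTop (𝓝 l) := by
  obtain ⟨C, hC, hn⟩ := exists_norm_one_div_pow_le (a 0) (k 0)
  obtain ⟨B, hB, hBn⟩ := exists_norm_htmhs_le (fun j : Fin r => a j.succ) hk
    (δ := 1 / 2) (by norm_num)
  have hs : Summable fun n : ℕ =>
      1 / ((n : ℂ) + a 0) ^ k 0 * htmhs n (fun j : Fin r => k j.succ) fun j => a j.succ := by
    refine Summable.of_norm_bounded
      ((summable_natCast_add_one_rpow (c := -2 + 1 / 2) (by norm_num)).mul_left (C * B))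
      fun n => ?_
    have hp : (1 : ℝ) ≤ (n : ℝ) + 1 := by have : (0 : ℝ) ≤ n := n.cast_nonneg; linarith
    have h1 := hn n
    have h2 := hBn n
    rw [norm_mul, Real.rpow_add (by positivity)]
    calc _ ≤ C / ((n : ℝ) + 1) ^ k 0 * (B * ((n : ℝ) + 1) ^ (1 / 2 : ℝ)) := by gcongr
      _ ≤ C / ((n : ℝ) + 1) ^ 2 * (B * ((n : ℝ) + 1) ^ (1 / 2 : ℝ)) := by gcongr
      _ = _ := by
        rw [Real.rpow_neg (by positivity), Real.rpow_ofNat]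
        ring
  exact ⟨_, hs.hasSum.tendsto_sum_nat.congr fun N => (htmhs_eq_sum N k a).symm⟩

theorem tendsto_htmhs_htmzv {r : ℕ} {k : Fin (r + 1) → ℕ} (a : Fin (r + 1) → ℂ)
    (h0 : 2 ≤ k 0) (hk : ∀ j : Fin r, 1 ≤ k j.succ) :
    Tendsto (fun N => htmhs N k a) atTop (𝓝 (htmzv k a)) :=
  tendsto_nhds_limUnder (exists_tendsto_htmhs a h0 hk)

theorem summable_regTerm {d : ℕ} (α β : ℂ) (i : Fin (d + 1) → ℕ) :
    Summable fun n : ℕ => regTerm α β i n := by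
  obtain ⟨C, hC, hn⟩ := exists_norm_one_div_pow_le (1 - β) 1
  obtain ⟨E, hE, hEn⟩ := exists_norm_one_div_pow_le (1 - α - β) 1
  obtain ⟨B, hB, hBn⟩ := exists_norm_htmhs_le (fun _ : Fin d => 1 - β)
    (k := fun j : Fin d => i j.succ + 1) (fun _ => by omega) (δ := 1 / 2) (by norm_num)
  refine Summable.of_norm_bounded
    ((summable_natCast_add_one_rpow (c := -2 + 1 / 2) (by norm_num)).mul_left (B * C * E))
    fun n => ?_
  have h1 := hn n
  have h2 := hEn n
  have h3 := hBn n
  rw [pow_one, pow_one] at h1 h2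
  unfold regTerm
  rw [show ((n + 1 : ℕ) : ℂ) - β = n + (1 - β) by push_cast; ring,
    show ((n + 1 : ℕ) : ℂ) - α - β = n + (1 - α - β) by push_cast; ring, ← div_div,
    div_eq_mul_one_div, div_eq_mul_one_div (htmhs _ _ _), norm_mul, norm_mul,
    Real.rpow_add (by positivity)]
  calc _ ≤ B * ((n : ℝ) + 1) ^ (1 / 2 : ℝ) * (C / ((n : ℝ) + 1)) * (E / ((n : ℝ) + 1)) := by gcongr
    _ = _ := by
      rw [Real.rpow_neg (by positivity), Real.rpow_ofNat]
      field_simp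

/-- Partial fractions: 1/(n-α-β) - 1/(n-β) = α/((n-β)(n-α-β)). -/
theorem tendsto_htmhs_sub_htmhs {d : ℕ} {α β : ℂ} (hβ : β.re < 1) (hαβ : (α + β).re < d + 1)
    {i : Fin (d + 1) → ℕ} {k : ℕ} (hi : i 0 = 0) (hk : k = 0) :
    Tendsto (fun N => htmhs N (expo k i) (vars d α β) - htmhs N (expo k i) fun _ => 1 - β) atTop
      (𝓝 (α * ∑' n : ℕ, regTerm α β i n)) := by
  have h := ((summable_regTerm α β i).hasSum.mul_left α).tendsto_sum_nat
  refine h.congr fun N => ?_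
  rw [htmhs_eq_sum, htmhs_eq_sum, ← Finset.sum_sub_distrib]
  refine Finset.sum_congr rfl fun n _ => ?_
  simp only [expo, vars, Fin.cons_zero, Fin.cons_succ, hi, hk, zero_add, pow_one, regTerm]
  -- A zero of n + 1 - α - β can occur only for n < d, where the inner sum is empty.
  rcases lt_or_ge n d with hn | hn
  · rw [htmhs_eq_zero hn]
    simp
  · have hn' : (d : ℝ) ≤ n := by exact_mod_cast hn
    have h1 : (n : ℂ) + (1 - β) ≠ 0 := by
      rw [add_comm]
      exact add_natCast_ne_zero_of_re_pos (by simpa using hβ) n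
    have h2 : (n : ℂ) + (1 - α - β) ≠ 0 := fun h0 => by
      have := congrArg Complex.re h0
      simp at this hαβ
      linarith
    rw [show ((n + 1 : ℕ) : ℂ) - β = n + (1 - β) by push_cast; ring,
      show ((n + 1 : ℕ) : ℂ) - α - β = n + (1 - α - β) by push_cast; ring]
    field_simp
    ring

/-- The truncated difference has the same form in the regularized and the convergent case, so one
limit serves both. -/
theorem tendsto_zetaDiff {d : ℕ} {α β : ℂ} (hβ : β.re < 1) (hαβ : (α + β).re < d + 1)
    (i : Fin (d + 1) → ℕ) (k : ℕ) :
    Tendsto (fun N => htmhs N (expo k i) (vars d α β) -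
      (if k = 0 then 1 else 0) * htmhs N (expo k i) fun _ => 1 - β) atTop
      (𝓝 (zetaDiff k α β i)) := by
  unfold zetaDiff
  by_cases h : i 0 = 0 ∧ k = 0
  · simpa only [if_pos h, if_pos h.2, one_mul] using tendsto_htmhs_sub_htmhs hβ hαβ h.1 h.2
  · rw [if_neg h]
    have h0 : 2 ≤ expo k i 0 := by simp only [expo, Fin.cons_zero]; omega
    have hk : ∀ j : Fin d, 1 ≤ expo k i j.succ := fun j => by simp [expo]
    exact (tendsto_htmhs_htmzv _ h0 hk).sub ((tendsto_htmhs_htmzv _ h0 hk).const_mul _)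

theorem sum_binomSeriesDiff_mul_depthSum {d : ℕ} {α β : ℂ} (hα : ∀ j : ℕ, α ≠ -(j : ℂ))
    (hβ : β.re < 1) (hαβ : (α + β).re < d + 1) (k p N : ℕ) :
    ∑ ab ∈ antidiagonal p, ∑ q ∈ range N,
      binomSeriesDiff α (1 - β + q) 1 k ab.1 * depthSum (1 - β) d q ab.2 =
    ∑ i ∈ Finset.Nat.antidiagonalTuple (d + 1) p, ((i 0 + k).choose k : ℂ) *
      (htmhs N (expo k i) (vars d α β) -
        (if k = 0 then 1 else 0) * htmhs N (expo k i) fun _ => 1 - β) := by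
  rw [sum_antidiagonalTuple_succ]
  refine Finset.sum_congr rfl fun ab _ => ?_
  have hterm : ∀ q : ℕ, binomSeriesDiff α (1 - β + q) 1 k ab.1 * depthSum (1 - β) d q ab.2 =
      ∑ i ∈ Finset.Nat.antidiagonalTuple d ab.2, ((ab.1 + k).choose k : ℂ) *
        (1 / ((q : ℂ) + (1 - α - β)) ^ (ab.1 + k + 1) *
            htmhs q (fun t => i t + 1) (fun _ => 1 - β) -
          (if k = 0 then 1 else 0) * (1 / ((q : ℂ) + (1 - β)) ^ (ab.1 + k + 1) *
            htmhs q (fun t => i t + 1) fun _ => 1 - β)) := by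
    intro q
    rw [depthSum, Finset.mul_sum]
    refine Finset.sum_congr rfl fun i _ => ?_
    -- The evaluation needs Re α < Re (1-β+q), guaranteed once q ≥ d.
    rcases lt_or_ge q d with hq | hq
    · rw [htmhs_eq_zero hq]
      simp
    · have hq' : (d : ℝ) ≤ q := by exact_mod_cast hq
      have hq0 : (0 : ℝ) ≤ q := q.cast_nonneg
      rw [Complex.add_re] at hαβ
      rw [binomSeriesDiff_one hα (by simp; linarith) (by simp; linarith),
        show 1 - β + (q : ℂ) - α = q + (1 - α - β) by ring, add_comm (1 - β) (q : ℂ)]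
      by_cases hk : k = 0
      · subst hk
        simp
        ring
      · simp only [if_neg hk]
        ring
  simp only [hterm]
  rw [Finset.sum_comm]
  refine Finset.sum_congr rfl fun i _ => ?_
  rw [htmhs_eq_sum, htmhs_eq_sum, Finset.mul_sum, ← Finset.sum_sub_distrib, Finset.mul_sum]
  simp only [expo, vars, Fin.cons_zero, Fin.cons_succ]

theorem mainTheorem9 (m : ℤ) (hm : -1 ≤ m) (k p : ℕ) (α β : ℂ)
    (hα : ∀ j : ℕ, α ≠ -(j : ℂ)) (hβ : β.re < 1) (hαβ : (α + β).re < m + 2) :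
    -- every multiple zeta value on the right-hand side is a convergent limit
    (∀ i ∈ Finset.Nat.antidiagonalTuple ((m + 1).toNat + 1) p, ¬ (i 0 = 0 ∧ k = 0) →
      Tendsto (fun N : ℕ => htmhs N (expo k i) (vars (m + 1).toNat α β)) atTop
        (𝓝 (htmzv (expo k i) (vars (m + 1).toNat α β))) ∧
      Tendsto (fun N : ℕ => htmhs N (expo k i) (fun _ => 1 - β)) atTop
        (𝓝 (htmzv (expo k i) (fun _ => 1 - β)))) ∧
    -- for `i₁ = k = 0` the series that stands for the difference converges to it
    (∀ i ∈ Finset.Nat.antidiagonalTuple ((m + 1).toNat + 1) p, i 0 = 0 ∧ k = 0 →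
      Summable (fun n : ℕ => regTerm α β i n) ∧
      Tendsto (fun N : ℕ => htmhs N (expo k i) (vars (m + 1).toNat α β) -
          htmhs N (expo k i) (fun _ => 1 - β)) atTop
        (𝓝 (α * ∑' n : ℕ, regTerm α β i n))) ∧
    -- the evaluation
    HasSum (fun n : ℕ => aperyTerm m k p α β (n + 1))
      (∑ i ∈ Finset.Nat.antidiagonalTuple ((m + 1).toNat + 1) p,
        ((i 0 + k).choose k : ℂ) * zetaDiff k α β i) := by
  obtain ⟨d, rfl⟩ : ∃ d : ℕ, m = (d : ℤ) - 1 := ⟨(m + 1).toNat, by omega⟩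
  have hd : ((d : ℤ) - 1 + 1).toNat = d := by simp
  have hαβ' : (α + β).re < d + 1 := by push_cast at hαβ; linarith
  rw [hd]
  refine ⟨fun i _ h => ?_, fun i _ h => ⟨summable_regTerm α β i,
    tendsto_htmhs_sub_htmhs hβ hαβ' h.1 h.2⟩, ?_⟩
  · have h0 : 2 ≤ expo k i 0 := by simp only [expo, Fin.cons_zero]; omega
    have hk : ∀ j : Fin d, 1 ≤ expo k i j.succ := fun j => by simp [expo]
    exact ⟨tendsto_htmhs_htmzv _ h0 hk, tendsto_htmhs_htmzv _ h0 hk⟩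
  · have hx : 0 < (1 - β).re := by simpa using hβ
    have hre : α.re - (1 - β).re < d := by
      rw [Complex.add_re] at hαβ'
      simp
      linarith
    have hs := (summable_binomSeries hα hx (D := d + 1) (by push_cast; linarith) k p).hasSum
    -- At j = d, D = 0 all powers of n but the last are used up, and the truncated sums are exactly
    -- those of the right-hand side.
    have h1 := tendsto_sum_binomSeriesDiff_mul_depthSum hα hx hre k p d 0 rfl
    simp only [zero_add, sum_binomSeriesDiff_mul_depthSum hα hβ hαβ'] at h1
    have h2 := tendsto_finsetSum (Finset.Nat.antidiagonalTuple (d + 1) p) fun i _ =>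
      (tendsto_zetaDiff hβ hαβ' i k).const_mul ((i 0 + k).choose k : ℂ)
    rw [tendsto_nhds_unique h2 h1]
    simp only [aperyTerm_succ hα hβ]
    exact hs
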